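/- Let $U_1,\dots,U_n$ be pairwise disjoint non-empty finite sets. A choice function is a set $F\subseteq U_1\cup\dots\cup U_n$ with $|F\cap U_k|=1$ for all $1\le k\le n$; a partial choice function is a set $P\subseteq U_1\cup\dots\cup U_n$ with $|P\cap U_k|\le 1$ for all $1\le k\le n$, and its domain is $\operatorname{dom}(P)=\{1\le k\le n: U_k\cap P\ne\emptyset\}$. Let $P_1,\dots,P_m$ be a finite family of non-empty partial choice functions. For each $1\le k\le n$ let $M_k\subseteq U_k$ be a random subset of $U_k$, and suppose that $M_1,\dots,M_n$ are mutually independent. Let $M=\bigcup_{k=1}^n M_k$. If $$\mathbb{E}|M\cap U_k|\ \ge\ 1+\mathbb{E}\bigl|\{1\le j\le m: k\in\operatorname{dom}(P_j)\text{ and }P_j\subseteq M\}\bigr|$$ for all $1\le k\le n$, then there exists a choice function $F$ in which none of $P_1,\dots,P_m$ occurs, that is, $P_j\not\subseteq F$ for all $1\le j\le m$. -/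

import Mathlib

open MeasureTheory ProbabilityTheory

namespace ChoiceFun

variable {α : Type*} [DecidableEq α] {n m : ℕ}

/-- The ground set `U₁ ∪ … ∪ Uₙ`. -/
def ground (U : Fin n → Finset α) : Finset α := Finset.univ.biUnion U

/-- A choice function: a subset of `U₁ ∪ … ∪ Uₙ` with exactly one element in every `Uₖ`. -/
def IsChoice (U : Fin n → Finset α) (F : Finset α) : Prop :=
  F ⊆ ground U ∧ ∀ k, (F ∩ U k).card = 1

/-- A partial choice function: a subset of `U₁ ∪ … ∪ Uₙ` with at most one element in every
`Uₖ`. -/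
def IsPartialChoice (U : Fin n → Finset α) (P : Finset α) : Prop :=
  P ⊆ ground U ∧ ∀ k, (P ∩ U k).card ≤ 1

/-- The domain of a partial choice function: all `k` such that `Uₖ` meets `P`. -/
def dom (U : Fin n → Finset α) (P : Finset α) : Finset (Fin n) :=
  Finset.univ.filter fun k => (U k ∩ P).Nonempty

/-- `P` occurs in the choice function or multichoice function `M` if `P ⊆ M`. -/
def Occurs (P M : Finset α) : Prop := P ⊆ M

instance (P M : Finset α) : Decidable (Occurs P M) :=
  inferInstanceAs (Decidable (P ⊆ M))

/-- The set of indices `j` such that `k ∈ dom Pⱼ` and `Pⱼ` occurs in `M`. -/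
def occurringAt (U : Fin n → Finset α) (P : Fin m → Finset α) (k : Fin n) (M : Finset α) :
    Finset (Fin m) :=
  Finset.univ.filter fun j => k ∈ dom U (P j) ∧ Occurs (P j) M

end ChoiceFun

/-! Give each point the weight `p x`, the probability that `x ∈ M`, and a set the product of its
weights. Let W(S) be the total weight of the good choice functions on S. Extending these by a point
of `U k`, k ∉ S, yields weight (∑ p x) W(S); an extension containing some `P j` splits into `P j`
and a good choice function off `dom U (P j)` (`mul_goodWeight_le`). Inductively that remainder
weighs at most W(S), so the mean hypothesis gives W(S ∪ {k}) ≥ W(S) (`goodWeight_mono`). As W(∅) =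
1, W of all indices is positive. Independence identifies expected occurrences with weights. -/

namespace ChoiceFun

/-! ### Weighted counting of good choice functions -/

section Counting

variable {α : Type*} [DecidableEq α] {n m : ℕ}

/-- The choice functions on the index set `S` in which no `P j` occurs. -/
def goodChoices (U : Fin n → Finset α) (P : Fin m → Finset α) (S : Finset (Fin n)) :
    Finset (Finset α) :=
  (S.biUnion U).powerset.filter fun F => (∀ k ∈ S, (F ∩ U k).card = 1) ∧ ∀ j, ¬ P j ⊆ F

/-- The total weight of the choice functions on `S` in which no `P j` occurs. -/
noncomputable def goodWeight (U : Fin n → Finset α) (P : Fin m → Finset α) (p : α → ℝ)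
    (S : Finset (Fin n)) : ℝ :=
  ∑ F ∈ goodChoices U P S, ∏ x ∈ F, p x

theorem mem_goodChoices {U : Fin n → Finset α} {P : Fin m → Finset α} {S : Finset (Fin n)}
    {F : Finset α} :
    F ∈ goodChoices U P S ↔
      F ⊆ S.biUnion U ∧ (∀ k ∈ S, (F ∩ U k).card = 1) ∧ ∀ j, ¬ P j ⊆ F := by
  simp [goodChoices]

theorem mem_dom {U : Fin n → Finset α} {P : Finset α} {k : Fin n} :
    k ∈ dom U P ↔ ∃ x ∈ P, x ∈ U k := by
  simp only [dom, Finset.mem_filter, Finset.mem_univ, true_and, Finset.Nonempty, Finset.mem_inter]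
  exact ⟨fun ⟨x, h, h'⟩ => ⟨x, h', h⟩, fun ⟨x, h, h'⟩ => ⟨x, h', h⟩⟩

theorem goodWeight_nonneg (U : Fin n → Finset α) (P : Fin m → Finset α) {p : α → ℝ}
    (hp : ∀ x, 0 ≤ p x) (S : Finset (Fin n)) : 0 ≤ goodWeight U P p S :=
  Finset.sum_nonneg fun _ _ => Finset.prod_nonneg fun _ _ => hp _

/-- The empty set is good precisely because no `P j` is empty. -/
theorem goodWeight_empty (U : Fin n → Finset α) (P : Fin m → Finset α) (p : α → ℝ)
    (hP : ∀ j, (P j).Nonempty) : goodWeight U P p ∅ = 1 := by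
  have h : goodChoices U P ∅ = {∅} := by
    ext F
    simp only [mem_goodChoices, Finset.biUnion_empty, Finset.subset_empty, Finset.mem_singleton]
    constructor
    · exact fun h => h.1
    · rintro rfl
      simpa using fun j => (hP j).ne_empty
  simp [goodWeight, h]

theorem notMem_of_subset_biUnion {U : Fin n → Finset α}
    (hU : ∀ k l : Fin n, k ≠ l → Disjoint (U k) (U l)) {S : Finset (Fin n)} {k : Fin n}
    (hk : k ∉ S) {F : Finset α} (hF : F ⊆ S.biUnion U) {x : α} (hx : x ∈ U k) : x ∉ F := by
  intro hxF
  obtain ⟨l, hl, hxl⟩ := Finset.mem_biUnion.1 (hF hxF)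
  exact Finset.disjoint_left.1 (hU k l fun h => hk (h ▸ hl)) hx hxl

/-- Removing an occurring partial choice function from a one-point extension of a good choice
function leaves a good choice function on the complement of its domain. -/
theorem insert_sdiff_mem_goodChoices {U : Fin n → Finset α}
    (hU : ∀ k l : Fin n, k ≠ l → Disjoint (U k) (U l)) {P : Fin m → Finset α}
    {S : Finset (Fin n)} {k : Fin n} (hk : k ∉ S) {F : Finset α} (hF : F ∈ goodChoices U P S)
    {x : α} (hx : x ∈ U k) {j : Fin m} (hj : P j ⊆ insert x F) :
    insert x F \ P j ∈ goodChoices U P (insert k S \ dom U (P j)) := by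
  obtain ⟨hFs, hF1, hFP⟩ := mem_goodChoices.1 hF
  -- Otherwise `P j` would already occur in the good function `F`.
  have hxP : x ∈ P j := by
    by_contra h
    exact hFP j ((Finset.subset_insert_iff_of_notMem h).1 hj)
  have hsub : insert x F \ P j ⊆ F := by
    intro y hy
    rw [Finset.mem_sdiff, Finset.mem_insert] at hy
    rcases hy with ⟨rfl | h, h'⟩
    · exact absurd hxP h'
    · exact h
  refine mem_goodChoices.2 ⟨fun y hy => ?_, fun l hl => ?_, fun i hi => hFP i (hi.trans hsub)⟩
  · have hyF := hsub hy
    obtain ⟨l, hl, hyl⟩ := Finset.mem_biUnion.1 (hFs hyF)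
    refine Finset.mem_biUnion.2 ⟨l, Finset.mem_sdiff.2 ⟨Finset.mem_insert_of_mem hl, ?_⟩, hyl⟩
    intro hld
    obtain ⟨z, hzP, hzl⟩ := mem_dom.1 hld
    have hzF : z ∈ F := by
      rcases Finset.mem_insert.1 (hj hzP) with rfl | h
      · exact absurd hzl (Finset.disjoint_left.1 (hU k l fun h => hk (h ▸ hl)) hx)
      · exact h
    have : y = z := Finset.card_le_one.1 (hF1 l hl).le y (Finset.mem_inter.2 ⟨hyF, hyl⟩) z
      (Finset.mem_inter.2 ⟨hzF, hzl⟩)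
    exact (Finset.mem_sdiff.1 hy).2 (this ▸ hzP)
  · obtain ⟨hl, hld⟩ := Finset.mem_sdiff.1 hl
    have hlS : l ∈ S := by
      rcases Finset.mem_insert.1 hl with rfl | h
      · exact absurd (mem_dom.2 ⟨x, hxP, hx⟩) hld
      · exact h
    rw [← hF1 l hlS]
    congr 1
    ext y
    simp only [Finset.mem_inter]
    refine and_congr_left fun hyl => ⟨fun h => hsub h, fun h => ?_⟩
    exact Finset.mem_sdiff.2 ⟨Finset.mem_insert_of_mem h, fun hyP => hld (mem_dom.2 ⟨y, hyP, hyl⟩)⟩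

theorem insert_mem_goodChoices {U : Fin n → Finset α}
    (hU : ∀ k l : Fin n, k ≠ l → Disjoint (U k) (U l)) {P : Fin m → Finset α}
    {S : Finset (Fin n)} {k : Fin n} (hk : k ∉ S) {F : Finset α} (hF : F ∈ goodChoices U P S)
    {x : α} (hx : x ∈ U k) (hP : ∀ j, ¬ P j ⊆ insert x F) :
    insert x F ∈ goodChoices U P (insert k S) := by
  obtain ⟨hFs, hF1, -⟩ := mem_goodChoices.1 hF
  refine mem_goodChoices.2 ⟨?_, fun l hl => ?_, hP⟩
  · rw [Finset.biUnion_insert]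
    exact Finset.insert_subset (Finset.mem_union_left _ hx)
      (hFs.trans Finset.subset_union_right)
  · rcases Finset.mem_insert.1 hl with rfl | hlS
    · rw [Finset.card_eq_one]
      refine ⟨x, ?_⟩
      ext y
      simp only [Finset.mem_inter, Finset.mem_insert, Finset.mem_singleton]
      constructor
      · rintro ⟨rfl | h, hy⟩
        · rfl
        · exact absurd h (notMem_of_subset_biUnion hU hk hFs hy)
      · rintro rfl
        exact ⟨Or.inl rfl, hx⟩
    · rw [Finset.insert_inter_of_notMem, hF1 l hlS]
      exact Finset.disjoint_left.1 (hU k l fun h => hk (h ▸ hlS)) hx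

/-- `F` misses `U k`, so `x` is recovered as the only point of the extension in `U k`. -/
theorem insert_injOn_goodChoices {U : Fin n → Finset α}
    (hU : ∀ k l : Fin n, k ≠ l → Disjoint (U k) (U l)) {P : Fin m → Finset α}
    {S : Finset (Fin n)} {k : Fin n} (hk : k ∉ S) :
    Set.InjOn (fun q : α × Finset α => insert q.1 q.2)
      (U k ×ˢ goodChoices U P S : Finset (α × Finset α)) := by
  rintro ⟨x, F⟩ hq ⟨y, G⟩ hr h
  simp only [Finset.coe_product, Set.mem_prod, Finset.mem_coe] at hq hr h
  have hxF := notMem_of_subset_biUnion hU hk (mem_goodChoices.1 hq.2).1 hq.1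
  have hyG := notMem_of_subset_biUnion hU hk (mem_goodChoices.1 hr.2).1 hr.1
  have hxy : x = y := by
    have : x ∈ insert y G := h ▸ Finset.mem_insert_self x F
    exact (Finset.mem_insert.1 this).resolve_right
      (notMem_of_subset_biUnion hU hk (mem_goodChoices.1 hr.2).1 hq.1)
  subst hxy
  rw [← Finset.erase_insert hxF, h, Finset.erase_insert hyG]

theorem mul_goodWeight_le {U : Fin n → Finset α}
    (hU : ∀ k l : Fin n, k ≠ l → Disjoint (U k) (U l)) {P : Fin m → Finset α} {p : α → ℝ}
    (hp : ∀ x, 0 ≤ p x) {S : Finset (Fin n)} {k : Fin n} (hk : k ∉ S) :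
    (∑ x ∈ U k, p x) * goodWeight U P p S ≤ goodWeight U P p (insert k S) +
      ∑ j with k ∈ dom U (P j), (∏ x ∈ P j, p x) * goodWeight U P p (insert k S \ dom U (P j)) := by
  set T := (U k ×ˢ goodChoices U P S).image fun q => insert q.1 q.2 with hT
  have hw : ∀ F : Finset α, 0 ≤ ∏ x ∈ F, p x := fun F => Finset.prod_nonneg fun _ _ => hp _
  have hTsum : (∑ x ∈ U k, p x) * goodWeight U P p S = ∑ F ∈ T, ∏ x ∈ F, p x := by
    rw [hT, Finset.sum_image (insert_injOn_goodChoices hU hk), goodWeight, Finset.sum_mul_sum,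
      Finset.sum_product]
    refine Finset.sum_congr rfl fun x hx => Finset.sum_congr rfl fun F hF => ?_
    rw [Finset.prod_insert (notMem_of_subset_biUnion hU hk (mem_goodChoices.1 hF).1 hx)]
  -- Deleting `P j` is injective on supersets of `P j` and divides off the factor `∏ x ∈ P j, p x`.
  have hbad : ∀ j, ∑ F ∈ T with P j ⊆ F, ∏ x ∈ F, p x ≤
      (∏ x ∈ P j, p x) * goodWeight U P p (insert k S \ dom U (P j)) := by
    intro j
    have hinj : Set.InjOn (fun F => F \ P j) (T.filter fun F => P j ⊆ F : Finset (Finset α)) := by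
      intro F hF G hG h
      rw [Finset.mem_coe, Finset.mem_filter] at hF hG
      rw [← Finset.sdiff_union_of_subset hF.2, ← Finset.sdiff_union_of_subset hG.2]
      exact congrArg (· ∪ P j) h
    have : ∑ F ∈ T with P j ⊆ F, ∏ x ∈ F, p x =
        (∏ x ∈ P j, p x) * ∑ F ∈ (T.filter fun F => P j ⊆ F).image (fun F => F \ P j),
          ∏ x ∈ F, p x := by
      rw [Finset.sum_image hinj, Finset.mul_sum]
      refine Finset.sum_congr rfl fun F hF => ?_
      rw [mul_comm, Finset.prod_sdiff (Finset.mem_filter.1 hF).2]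
    rw [this]
    refine mul_le_mul_of_nonneg_left
      (Finset.sum_le_sum_of_subset_of_nonneg ?_ fun F _ _ => hw F) (hw _)
    rintro _ hG
    obtain ⟨F, hF, rfl⟩ := Finset.mem_image.1 hG
    obtain ⟨hF, hPF⟩ := Finset.mem_filter.1 hF
    obtain ⟨⟨x, F⟩, hq, rfl⟩ := Finset.mem_image.1 hF
    obtain ⟨hx, hF⟩ := Finset.mem_product.1 hq
    exact insert_sdiff_mem_goodChoices hU hk hF hx hPF
  have hcover : T ⊆ goodChoices U P (insert k S) ∪
      (Finset.univ.filter fun j => k ∈ dom U (P j)).biUnion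
        fun j => T.filter fun F => P j ⊆ F := by
    intro G hG
    obtain ⟨⟨x, F⟩, hq, rfl⟩ := Finset.mem_image.1 hG
    obtain ⟨hx, hF⟩ := Finset.mem_product.1 hq
    by_cases h : ∃ j, P j ⊆ insert x F
    · obtain ⟨j, hj⟩ := h
      refine Finset.mem_union_right _ (Finset.mem_biUnion.2 ⟨j, ?_, Finset.mem_filter.2 ⟨hG, hj⟩⟩)
      refine Finset.mem_filter.2 ⟨Finset.mem_univ _, mem_dom.2 ⟨x, ?_, hx⟩⟩
      by_contra hxP
      exact (mem_goodChoices.1 hF).2.2 j ((Finset.subset_insert_iff_of_notMem hxP).1 hj)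
    · exact Finset.mem_union_left _ (insert_mem_goodChoices hU hk hF hx (not_exists.1 h))
  have hunion : ∀ A B : Finset (Finset α), ∑ F ∈ A ∪ B, ∏ x ∈ F, p x ≤
      ∑ F ∈ A, ∏ x ∈ F, p x + ∑ F ∈ B, ∏ x ∈ F, p x := fun A B => by
    rw [← Finset.sum_union_inter]
    exact le_add_of_nonneg_right (Finset.sum_nonneg fun F _ => hw F)
  have hbiUnion : ∀ (J : Finset (Fin m)) (B : Fin m → Finset (Finset α)),
      ∑ F ∈ J.biUnion B, ∏ x ∈ F, p x ≤ ∑ j ∈ J, ∑ F ∈ B j, ∏ x ∈ F, p x := by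
    intro J B
    induction J using Finset.induction_on with
    | empty => simp
    | insert j J hj ih =>
      rw [Finset.biUnion_insert, Finset.sum_insert hj]
      exact (hunion _ _).trans (add_le_add le_rfl ih)
  rw [hTsum]
  refine (Finset.sum_le_sum_of_subset_of_nonneg hcover fun F _ _ => hw F).trans
    ((hunion _ _).trans (add_le_add le_rfl ((hbiUnion _ _).trans ?_)))
  exact Finset.sum_le_sum fun j _ => hbad j

theorem goodWeight_mono {U : Fin n → Finset α}
    (hU : ∀ k l : Fin n, k ≠ l → Disjoint (U k) (U l)) {P : Fin m → Finset α} {p : α → ℝ}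
    (hp : ∀ x, 0 ≤ p x)
    (h : ∀ k, 1 + ∑ j with k ∈ dom U (P j), ∏ x ∈ P j, p x ≤ ∑ x ∈ U k, p x) :
    Monotone (goodWeight U P p) := by
  suffices ∀ T A : Finset (Fin n), A ⊆ T → goodWeight U P p A ≤ goodWeight U P p T from
    fun A T hAT => this T A hAT
  intro T
  -- The recurrence compares `T.erase k` with `T \ dom U (P j)`, possibly far smaller, so the
  -- induction carries all subsets at once.
  induction T using Finset.strongInduction with
  | H T ih =>
    intro A hAT
    rcases hAT.eq_or_ssubset with rfl | hlt
    · exact le_rfl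
    obtain ⟨k, hkT, hkA⟩ := Finset.exists_of_ssubset hlt
    have ihS := ih (T.erase k) (Finset.erase_ssubset hkT)
    refine (ihS A (Finset.subset_erase.2 ⟨hAT, hkA⟩)).trans ?_
    have hstep := mul_goodWeight_le (P := P) hU hp (Finset.notMem_erase k T)
    rw [Finset.insert_erase hkT] at hstep
    have hsum : ∑ j with k ∈ dom U (P j), (∏ x ∈ P j, p x) * goodWeight U P p (T \ dom U (P j)) ≤
        (∑ j with k ∈ dom U (P j), ∏ x ∈ P j, p x) * goodWeight U P p (T.erase k) := by
      rw [Finset.sum_mul]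
      refine Finset.sum_le_sum fun j hj => mul_le_mul_of_nonneg_left (ihS _ ?_)
        (Finset.prod_nonneg fun _ _ => hp _)
      exact Finset.subset_erase.2 ⟨Finset.sdiff_subset, fun hk =>
        (Finset.mem_sdiff.1 hk).2 (Finset.mem_filter.1 hj).2⟩
    have := mul_le_mul_of_nonneg_right (h k) (goodWeight_nonneg U P hp (T.erase k))
    linarith

/-- The weighted counting criterion for choice functions avoiding a family of partial ones. -/
theorem exists_isChoice_of_weight {U : Fin n → Finset α}
    (hU : ∀ k l : Fin n, k ≠ l → Disjoint (U k) (U l)) {P : Fin m → Finset α}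
    (hP : ∀ j, (P j).Nonempty) {p : α → ℝ} (hp : ∀ x, 0 ≤ p x)
    (h : ∀ k, 1 + ∑ j with k ∈ dom U (P j), ∏ x ∈ P j, p x ≤ ∑ x ∈ U k, p x) :
    ∃ F, IsChoice U F ∧ ∀ j, ¬ Occurs (P j) F := by
  have hpos : 0 < goodWeight U P p Finset.univ := by
    have := goodWeight_mono hU hp h (Finset.empty_subset Finset.univ)
    rw [goodWeight_empty U P p hP] at this
    linarith
  obtain ⟨F, hF, -⟩ := Finset.exists_ne_zero_of_sum_ne_zero hpos.ne'
  obtain ⟨hsub, hcard, hav⟩ := mem_goodChoices.1 hF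
  exact ⟨F, ⟨hsub, fun k => hcard k (Finset.mem_univ k)⟩, hav⟩

end Counting

/-! ### Expectations as weights -/

section Probability

variable {α : Type*} [DecidableEq α] {n : ℕ} {Ω : Type*} [MeasurableSpace Ω] {μ : Measure Ω}

theorem integral_card_filter [IsFiniteMeasure μ] {ι : Type*} (s : Finset ι) (q : ι → Ω → Prop)
    [∀ ω, DecidablePred fun i => q i ω] (hq : ∀ i, MeasurableSet {ω | q i ω}) :
    ∫ ω, ((s.filter fun i => q i ω).card : ℝ) ∂μ = ∑ i ∈ s, μ.real {ω | q i ω} := by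
  classical
  have : ∀ ω, ((s.filter fun i => q i ω).card : ℝ) =
      ∑ i ∈ s, {ω | q i ω}.indicator (fun _ => (1 : ℝ)) ω := by
    intro ω
    rw [Finset.card_filter]
    push_cast
    refine Finset.sum_congr rfl fun i _ => ?_
    simp [Set.indicator_apply]
  simp_rw [this]
  rw [integral_finsetSum _ fun i _ => (integrable_const _).indicator (hq i)]
  refine Finset.sum_congr rfl fun i _ => ?_
  rw [integral_indicator_const _ (hq i)]
  simp

theorem measurableSet_subset_biUnion {M : Fin n → Ω → Finset α}
    (hM : ∀ k, Measurable[inferInstance, (⊤ : MeasurableSpace (Finset α))] (M k))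
    (Q : Finset α) : MeasurableSet {ω | Q ⊆ Finset.univ.biUnion fun l => M l ω} := by
  have : {ω | Q ⊆ Finset.univ.biUnion fun l => M l ω} =
      ⋂ x ∈ Q, ⋃ l, M l ⁻¹' {A | x ∈ A} := by
    ext ω
    simp [Finset.subset_iff]
  rw [this]
  exact Finset.measurableSet_biInter _ fun x _ => MeasurableSet.iUnion fun l =>
    hM l (MeasurableSpace.measurableSet_top)

theorem measureReal_subset_biUnion_eq_prod {U : Fin n → Finset α}
    (hU : ∀ k l : Fin n, k ≠ l → Disjoint (U k) (U l)) {M : Fin n → Ω → Finset α}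
    (hM_sub : ∀ k ω, M k ω ⊆ U k)
    (hM_indep : iIndepFun (m := fun _ => (⊤ : MeasurableSpace (Finset α))) M μ)
    {Q : Finset α} (hQ : IsPartialChoice U Q) :
    μ.real {ω | Q ⊆ Finset.univ.biUnion fun l => M l ω} =
      ∏ x ∈ Q, μ.real {ω | x ∈ Finset.univ.biUnion fun l => M l ω} := by
  have hmem : ∀ {x : α} {k : Fin n} (ω : Ω), x ∈ U k →
      (x ∈ (Finset.univ.biUnion fun l => M l ω) ↔ x ∈ M k ω) := by
    intro x k ω hx
    simp only [Finset.mem_biUnion, Finset.mem_univ, true_and]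
    refine ⟨fun ⟨l, hl⟩ => ?_, fun h => ⟨k, h⟩⟩
    by_cases hkl : k = l
    · exact hkl ▸ hl
    · exact absurd (hM_sub l ω hl) (Finset.disjoint_left.1 (hU k l hkl) hx)
  -- The event splits into one condition per block, each depending on a single `M k`, so
  -- independence applies.
  have hset : {ω | Q ⊆ Finset.univ.biUnion fun l => M l ω} =
      ⋂ k ∈ (Finset.univ : Finset (Fin n)), M k ⁻¹' {A | Q ∩ U k ⊆ A} := by
    ext ω
    simp only [Set.mem_ofPred_eq, Set.mem_iInter, Set.mem_preimage, Finset.mem_univ, true_imp_iff]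
    constructor
    · intro h k x hx
      obtain ⟨hxQ, hxk⟩ := Finset.mem_inter.1 hx
      exact (hmem ω hxk).1 (h hxQ)
    · intro h x hx
      obtain ⟨k, -, hxk⟩ := Finset.mem_biUnion.1 (hQ.1 hx)
      exact (hmem ω hxk).2 (h k (Finset.mem_inter.2 ⟨hx, hxk⟩))
  have hQU : Q = Finset.univ.biUnion fun k => Q ∩ U k := by
    rw [← Finset.inter_biUnion]
    exact (Finset.inter_eq_left.2 hQ.1).symm
  have := hM_indep.isProbabilityMeasure
  rw [hset, measureReal_def, hM_indep.measure_inter_preimage_eq_mul Finset.univ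
    (fun _ _ => MeasurableSpace.measurableSet_top), ENNReal.toReal_prod]
  conv_rhs => rw [hQU]
  rw [Finset.prod_biUnion fun k _ l _ hkl =>
    (hU k l hkl).mono Finset.inter_subset_right Finset.inter_subset_right]
  refine Finset.prod_congr rfl fun k _ => ?_
  -- A block contains at most one point of `Q`; an empty block contributes a sure event, of
  -- probability 1. Points within one block need not be independent.
  rcases (Q ∩ U k).eq_empty_or_nonempty with h0 | ⟨x, hx⟩
  · simp [h0]
  · have h1 : Q ∩ U k = {x} := Finset.eq_singleton_iff_unique_mem.2
      ⟨hx, fun y hy => Finset.card_le_one.1 (hQ.2 k) y hy x hx⟩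
    rw [h1, Finset.prod_singleton, measureReal_def]
    congr 2
    ext ω
    simp only [Set.mem_preimage, Set.mem_ofPred_eq, Finset.singleton_subset_iff]
    exact (hmem ω (Finset.mem_inter.1 hx).2).symm

end Probability

end ChoiceFun

theorem theorem4p11 {α : Type*} [DecidableEq α] {n m : ℕ}
    (U : Fin n → Finset α)
    (hU_disj : ∀ k l : Fin n, k ≠ l → Disjoint (U k) (U l))
    (hU_ne : ∀ k, (U k).Nonempty)
    (P : Fin m → Finset α)
    (hP : ∀ j, ChoiceFun.IsPartialChoice U (P j))
    (hP_ne : ∀ j, (P j).Nonempty)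
    {Ω : Type*} [MeasurableSpace Ω] (μ : Measure Ω) [IsProbabilityMeasure μ]
    (M : Fin n → Ω → Finset α)
    (hM_meas : ∀ k, Measurable[inferInstance, (⊤ : MeasurableSpace (Finset α))] (M k))
    (hM_sub : ∀ k ω, M k ω ⊆ U k)
    (hM_indep : iIndepFun (m := fun _ => (⊤ : MeasurableSpace (Finset α))) M μ)
    (hM_mean : ∀ k : Fin n,
      ∫ ω, (((Finset.univ.biUnion fun l => M l ω) ∩ U k).card : ℝ) ∂μ ≥
        1 + ∫ ω, ((ChoiceFun.occurringAt U P k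
          (Finset.univ.biUnion fun l => M l ω)).card : ℝ) ∂μ) :
    ∃ F : Finset α, ChoiceFun.IsChoice U F ∧ ∀ j, ¬ ChoiceFun.Occurs (P j) F := by
  classical
  have hsingle : ∀ x, MeasurableSet {ω | x ∈ Finset.univ.biUnion fun l => M l ω} := fun x => by
    simpa only [Finset.singleton_subset_iff] using
      ChoiceFun.measurableSet_subset_biUnion hM_meas {x}
  refine ChoiceFun.exists_isChoice_of_weight hU_disj hP_ne
    (p := fun x => μ.real {ω | x ∈ Finset.univ.biUnion fun l => M l ω})
    (fun _ => measureReal_nonneg) fun k => ?_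
  have h := hM_mean k
  have hleft : ∫ ω, (((Finset.univ.biUnion fun l => M l ω) ∩ U k).card : ℝ) ∂μ =
      ∑ x ∈ U k, μ.real {ω | x ∈ Finset.univ.biUnion fun l => M l ω} := by
    rw [← ChoiceFun.integral_card_filter _ _ hsingle]
    simp only [Finset.filter_mem_eq_inter, Finset.inter_comm]
  have hright : ∫ ω, ((ChoiceFun.occurringAt U P k
        (Finset.univ.biUnion fun l => M l ω)).card : ℝ) ∂μ =
      ∑ j with k ∈ ChoiceFun.dom U (P j),
        ∏ x ∈ P j, μ.real {ω | x ∈ Finset.univ.biUnion fun l => M l ω} := by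
    simp only [← ChoiceFun.measureReal_subset_biUnion_eq_prod hU_disj hM_sub hM_indep (hP _)]
    rw [← ChoiceFun.integral_card_filter _ _
      fun j => ChoiceFun.measurableSet_subset_biUnion hM_meas (P j)]
    simp only [ChoiceFun.occurringAt, ChoiceFun.Occurs, Finset.filter_filter]
    congr!
  rw [hleft, hright] at h
  exact h
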